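/- For $n\ge 0$ let $P_n(z)=\frac{1}{2^n n!}\frac{d^n}{dz^n}(z^2-1)^n$ be the Legendre polynomial of degree $n$, and for $z\in\mathbb{C}\setminus[-1,1]$ let $$Q_n(z)=\frac12\int_{-1}^{1}\frac{P_n(x)}{z-x}\,dx$$ be the Legendre function of the second kind. Let $\sqrt{z^2-1}$ denote the branch that is holomorphic on $\mathbb{C}\setminus[-1,1]$ and positive for real $z>1$, namely $\sqrt{z-1}\,\sqrt{z+1}$ with principal square roots. Fix a real $M>0$ and, for $n\ge 2$, let $$\Omega_{B,n}=\Bigl\{z\in\mathbb{C} : \bigl|z+\sqrt{z^2-1}\bigr| = 1+\frac{M\log n}{n}\Bigr\}$$ be the Bernstein ellipse. Then $|Q_n(z)/P_n(z)| = O(n^{-2M})$ as $n\to\infty$, uniformly for $z\in\Omega_{B,n}$; that is, there are a constant $C$ and an integer $N\ge 2$, depending only on $M$, such that for all $n\ge N$ and all $z\in\Omega_{B,n}$ one has $P_n(z)\neq 0$ and $$\left|\frac{Q_n(z)}{P_n(z)}\right|\le C\,n^{-2M}.$$ -/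

import Mathlib

open Filter

namespace GaussLegendre

/-- The Legendre polynomial `P_n`, given by the Rodrigues formula
`P_n(x) = 1 / (2 ^ n n!) (d/dx)^n (x ^ 2 - 1) ^ n`. -/
noncomputable def legendreP (n : ℕ) : Polynomial ℂ :=
  Polynomial.C (1 / (2 ^ n * (n.factorial : ℂ))) *
    Polynomial.derivative^[n] ((Polynomial.X ^ 2 - 1) ^ n)

/-- The Legendre function of the second kind,
`Q_n(s) = (1 / 2) ∫_{-1}^{1} P_n(x) / (s - x) dx`, for `s` outside `[-1, 1]`
(where the integrand is continuous). -/
noncomputable def legendreQ (n : ℕ) (s : ℂ) : ℂ :=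
  (1 / 2) * ∫ x in (-1 : ℝ)..1, (legendreP n).eval (x : ℂ) / (s - (x : ℂ))

/-- The branch of `√(z ^ 2 - 1)` that is holomorphic off the cut `[-1, 1]` and positive for `z > 1`:
the product of the principal square roots of `z - 1` and `z + 1`. (The principal square root of
`z ^ 2 - 1` would instead jump across the imaginary axis.) -/
noncomputable def sqrtSqSubOne (z : ℂ) : ℂ :=
  (z - 1) ^ (1 / 2 : ℂ) * (z + 1) ^ (1 / 2 : ℂ)

/-- The Bernstein ellipse (the curve) with foci `±1` and parameter `ρ > 1`. -/
def bernsteinEllipse (ρ : ℝ) : Set ℂ :=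
  {z : ℂ | ‖z + sqrtSqSubOne z‖ = ρ}

end GaussLegendre

/-! Put `z = (t + 1/t)/2` with `‖t‖ = 1/ρ < 1` and `w = t²`. With `a_k` the coefficients of `(1 -
x)^(-1/2)` and `b_j = 2/((2j+1) a_j)`, both functions have explicit expansions: `t^n P_n(z) =
∑_{i+j=n} a_i a_j w^i` and `Q_n(z) = t^(n+1) ∑ a_k b_{n+k} w^k`. Each follows from the three-term
recurrence in `n` and the initial values (`legendreP_eval_eq`, `legendreQ_eq`).

Both sums have the form `∑ a_k β_k w^k`. Multiplied by `(1 - w)^(1/2)`, such a series has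
coefficients of known sign wherever `β` is monotone, so the sum of their absolute values can be read
off from the series at the real point `‖w‖`. This replaces asymptotics uniform in `arg w`. For
`Q_n`, `β` decreases and the product is at most `2 b_n ≤ 8 a_n`. For `P_n`, `β_k = a_{n-k}`
increases up to `k = n` and then drops to zero; the product is at least `2 a_n` minus its value at
`‖w‖`, which is `a_n (1 + small)`, minus twice a tail of size `‖w‖^n a_n log n`. Once the errors are
small it exceeds `a_n / 2`.

The factor `(1 - w)^(1/2)` cancels in the quotient, so `P_n(z) ≠ 0` and `‖Q_n / P_n‖ ≤ 16 ‖t‖^(2n)`.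
On the ellipse, with `y = M log n`, `‖t‖^n = (1 + y/n)^(-n) ≤ e^(1-y)`, which gives `16 e² n^(-2M)`.
The errors vanish because `n(1 - ‖w‖)` is of order `y → ∞`, while `‖t‖^n` beats every power of `y`.
-/

namespace GaussLegendre

open Finset

/-! ### Three-term recurrence for convolutions -/

section Antidiagonal

variable {K : Type*} [Field K] [CharZero K]

/-- Convolutions of two sequences satisfying the first-order recurrences of the coefficients of
`(1 - w h) ^ (-1 / 2)` and `(1 - h) ^ (-1 / 2)` obey a three-term recurrence. -/
theorem antidiagonal_three_term {x y : ℕ → K} {w : K}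
    (hx : ∀ i : ℕ, ((i : K) + 1) * x (i + 1) = (i + 1 / 2) * w * x i)
    (hy : ∀ i : ℕ, ((i : K) + 1) * y (i + 1) = (i + 1 / 2) * y i) (n : ℕ) :
    ((n : K) + 2) * ∑ ij ∈ antidiagonal (n + 2), x ij.1 * y ij.2
      = (n + 3 / 2) * (1 + w) * ∑ ij ∈ antidiagonal (n + 1), x ij.1 * y ij.2
        - (n + 1) * w * ∑ ij ∈ antidiagonal n, x ij.1 * y ij.2 := by
  set p : ℕ → K := fun n => ∑ ij ∈ antidiagonal n, x ij.1 * y ij.2 with hp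
  -- `A` and `B` apply the Euler operator `h d/dh` to one factor of the generating function each.
  -- Their sum multiplies by `n`, and `hx`, `hy` make each a first-order recurrence; eliminating
  -- them gives the claim.
  set A : ℕ → K := fun n => ∑ ij ∈ antidiagonal n, (ij.1 : K) * x ij.1 * y ij.2 with hA
  set B : ℕ → K := fun n => ∑ ij ∈ antidiagonal n, (ij.2 : K) * x ij.1 * y ij.2 with hB
  have hAs : ∀ n, A (n + 1) = w * (A n + 1 / 2 * p n) := by
    intro n
    simp only [hA, hp]
    rw [Finset.Nat.sum_antidiagonal_succ, mul_sum, ← sum_add_distrib, mul_sum]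
    simp only [Nat.cast_zero, zero_mul, zero_add]
    refine sum_congr rfl fun ij _ => ?_
    push_cast
    rw [hx]; ring
  have hBs : ∀ n, B (n + 1) = B n + 1 / 2 * p n := by
    intro n
    simp only [hB, hp]
    rw [Finset.Nat.sum_antidiagonal_succ', mul_sum, ← sum_add_distrib]
    simp only [Nat.cast_zero, zero_mul, zero_add]
    refine sum_congr rfl fun ij _ => ?_
    push_cast
    linear_combination x ij.1 * hy ij.2
  have hAB : ∀ n, A n + B n = n * p n := by
    intro n
    simp only [hA, hB, hp]
    rw [mul_sum, ← sum_add_distrib]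
    refine sum_congr rfl fun ij hij => ?_
    rw [HasAntidiagonal.mem_antidiagonal] at hij
    rw [← hij]; push_cast; ring
  have h0 := hAB n
  have h1 := hAB (n + 1)
  have h2 := hAB (n + 2)
  have e1 := hAs n
  have e2 := hBs n
  have e3 := hAs (n + 1)
  have e4 := hBs (n + 1)
  change ((n : K) + 2) * p (n + 2) = (n + 3 / 2) * (1 + w) * p (n + 1) - (n + 1) * w * p n
  push_cast at h0 h1 h2
  linear_combination -h2 + e3 + e4 + (1 + w) * h1 - w * h0 - w * e2 - e1

end Antidiagonal

/-! ### Coefficients of `(1 - x)^(±1/2)` -/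

/-- The coefficients `(2k choose k) / 4 ^ k` of `(1 - x) ^ (-1 / 2)`. -/
noncomputable def invSqrtCoeff : ℕ → ℝ
  | 0 => 1
  | k + 1 => invSqrtCoeff k * ((2 * k + 1) / (2 * k + 2))

@[simp] theorem invSqrtCoeff_zero : invSqrtCoeff 0 = 1 := rfl

theorem invSqrtCoeff_succ (k : ℕ) :
    ((k : ℝ) + 1) * invSqrtCoeff (k + 1) = (k + 1 / 2) * invSqrtCoeff k := by
  rw [invSqrtCoeff]; field_simp

theorem invSqrtCoeff_pos (k : ℕ) : 0 < invSqrtCoeff k := by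
  induction k with
  | zero => simp
  | succ k ih => rw [invSqrtCoeff]; positivity

theorem invSqrtCoeff_antitone : Antitone invSqrtCoeff := by
  refine antitone_nat_of_succ_le fun k => ?_
  rw [invSqrtCoeff]
  refine mul_le_of_le_one_right (invSqrtCoeff_pos k).le ?_
  rw [div_le_one (by positivity)]; linarith

theorem invSqrtCoeff_le_one (k : ℕ) : invSqrtCoeff k ≤ 1 :=
  invSqrtCoeff_antitone (Nat.zero_le k)

/-- The square of `(1 - x)^(-1/2)` is the geometric series. At `w = 1` the constant sequence `1`
solves the three-term recurrence. -/
theorem sum_antidiagonal_invSqrtCoeff (n : ℕ) :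
    ∑ ij ∈ antidiagonal n, invSqrtCoeff ij.1 * invSqrtCoeff ij.2 = 1 := by
  induction n using Nat.twoStepInduction with
  | zero => simp
  | one => simp [Finset.Nat.antidiagonal_succ, invSqrtCoeff]; norm_num
  | more n h0 h1 =>
    have h := antidiagonal_three_term (x := invSqrtCoeff) (y := invSqrtCoeff) (w := 1)
      (fun i => by rw [invSqrtCoeff_succ]; ring) invSqrtCoeff_succ n
    rw [h0, h1] at h
    have h2 : ((n : ℝ) + 2) ≠ 0 := by positivity
    apply mul_left_cancel₀ h2
    rw [h]; ring

theorem sum_range_invSqrtCoeff (n : ℕ) :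
    ∑ i ∈ range (n + 1), invSqrtCoeff i = (2 * n + 1) * invSqrtCoeff n := by
  induction n with
  | zero => simp
  | succ n ih =>
    rw [sum_range_succ, ih]
    push_cast
    linear_combination -2 * invSqrtCoeff_succ n

/-- With `one_le_invSqrtCoeff_sq` this gives `1/(4n+1) ≤ a_n² ≤ 1/(2n+1)`, which serves everywhere
in place of Stirling's formula. -/
theorem invSqrtCoeff_sq_le (n : ℕ) : invSqrtCoeff n ^ 2 * (2 * n + 1) ≤ 1 := by
  induction n with
  | zero => simp
  | succ n ih =>
    refine le_trans ?_ ih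
    rw [invSqrtCoeff, mul_pow, mul_assoc]
    refine mul_le_mul_of_nonneg_left ?_ (sq_nonneg _)
    push_cast
    rw [div_pow, div_mul_eq_mul_div, div_le_iff₀ (by positivity)]
    nlinarith [Nat.cast_nonneg (α := ℝ) n]

theorem invSqrtCoeff_sq_mul_monotone :
    Monotone fun n : ℕ => invSqrtCoeff n ^ 2 * (4 * n + 1) := by
  refine monotone_nat_of_le_succ fun n => ?_
  rw [invSqrtCoeff, mul_pow, mul_assoc]
  refine mul_le_mul_of_nonneg_left ?_ (sq_nonneg _)
  push_cast
  rw [div_pow, div_mul_eq_mul_div, le_div_iff₀ (by positivity)]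
  nlinarith [Nat.cast_nonneg (α := ℝ) n]

theorem one_le_invSqrtCoeff_sq (n : ℕ) : 1 ≤ invSqrtCoeff n ^ 2 * (4 * n + 1) := by
  simpa using invSqrtCoeff_sq_mul_monotone (Nat.zero_le n)

/-- The coefficients of `(1 - x) ^ (1 / 2)`. -/
noncomputable def sqrtCoeff : ℕ → ℝ
  | 0 => 1
  | k + 1 => invSqrtCoeff (k + 1) - invSqrtCoeff k

theorem sqrtCoeff_nonpos {k : ℕ} (hk : k ≠ 0) : sqrtCoeff k ≤ 0 := by
  obtain ⟨k, rfl⟩ := Nat.exists_eq_succ_of_ne_zero hk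
  exact sub_nonpos.2 (invSqrtCoeff_antitone k.le_succ)

theorem abs_sqrtCoeff_le_one (k : ℕ) : |sqrtCoeff k| ≤ 1 := by
  cases k with
  | zero => simp [sqrtCoeff]
  | succ k =>
    rw [sqrtCoeff, abs_le]
    constructor <;> linarith [invSqrtCoeff_le_one k, invSqrtCoeff_le_one (k + 1),
      invSqrtCoeff_pos k, invSqrtCoeff_pos (k + 1)]

/-- Multiplying by `(1 - x) ^ (1 / 2)` is multiplying by `(1 - x) ^ (-1 / 2)` and differencing. -/
theorem sum_antidiagonal_mul_sqrtCoeff (c : ℕ → ℝ) (k : ℕ) :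
    ∑ ij ∈ antidiagonal (k + 1), c ij.1 * sqrtCoeff ij.2
      = ∑ ij ∈ antidiagonal (k + 1), c ij.1 * invSqrtCoeff ij.2
        - ∑ ij ∈ antidiagonal k, c ij.1 * invSqrtCoeff ij.2 := by
  rw [Finset.Nat.sum_antidiagonal_succ', Finset.Nat.sum_antidiagonal_succ']
  simp only [sqrtCoeff, invSqrtCoeff_zero, mul_sub, sum_sub_distrib]
  ring

theorem sum_antidiagonal_invSqrtCoeff_mul_sqrtCoeff (k : ℕ) :
    ∑ ij ∈ antidiagonal (k + 1), invSqrtCoeff ij.1 * sqrtCoeff ij.2 = 0 := by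
  rw [sum_antidiagonal_mul_sqrtCoeff, sum_antidiagonal_invSqrtCoeff,
    sum_antidiagonal_invSqrtCoeff, sub_self]

/-! ### Multiplier transforms of `(1 - w)^(-1/2)` and their sign patterns -/

/-- The Taylor coefficients of `(1 - x) ^ (1 / 2) * ∑ a_k β_k x ^ k`, where `a_k` are those of
`(1 - x) ^ (-1 / 2)`. -/
noncomputable def weightedCoeff (β : ℕ → ℝ) (k : ℕ) : ℝ :=
  ∑ ij ∈ antidiagonal k, invSqrtCoeff ij.1 * β ij.1 * sqrtCoeff ij.2

@[simp] theorem weightedCoeff_zero (β : ℕ → ℝ) : weightedCoeff β 0 = β 0 := by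
  simp [weightedCoeff, sqrtCoeff]

/-- A constant multiplier contributes nothing in positive degree, since `(1 - x)^(-1/2) (1 -
x)^(1/2) = 1`. Subtracting `β (k + 1)` kills the only term with positive `sqrtCoeff`, so the sign
depends only on comparing `β i` with `β (k + 1)`. -/
theorem weightedCoeff_succ (β : ℕ → ℝ) (k : ℕ) :
    weightedCoeff β (k + 1) = ∑ ij ∈ antidiagonal (k + 1),
      invSqrtCoeff ij.1 * (β ij.1 - β (k + 1)) * sqrtCoeff ij.2 := by
  have h := sum_antidiagonal_invSqrtCoeff_mul_sqrtCoeff k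
  rw [weightedCoeff, ← sub_zero (∑ ij ∈ _, _), ← mul_zero (β (k + 1)), ← h, mul_sum,
    ← sum_sub_distrib]
  exact sum_congr rfl fun ij _ => by ring

theorem weightedCoeff_nonpos_of_le {β : ℕ → ℝ} {k : ℕ} (hk : k ≠ 0)
    (h : ∀ i ≤ k, β k ≤ β i) : weightedCoeff β k ≤ 0 := by
  obtain ⟨k, rfl⟩ := Nat.exists_eq_succ_of_ne_zero hk
  rw [Nat.succ_eq_add_one, weightedCoeff_succ]
  refine sum_nonpos fun ij hij => ?_
  rw [HasAntidiagonal.mem_antidiagonal] at hij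
  rcases eq_or_ne ij.2 0 with h0 | h0
  · have : ij.1 = k + 1 := by omega
    simp [this]
  · exact mul_nonpos_of_nonneg_of_nonpos (mul_nonneg (invSqrtCoeff_pos _).le
      (sub_nonneg.2 (h _ (by grind)))) (sqrtCoeff_nonpos h0)

theorem weightedCoeff_nonneg_of_le {β : ℕ → ℝ} {k : ℕ} (hk : k ≠ 0)
    (h : ∀ i ≤ k, β i ≤ β k) : 0 ≤ weightedCoeff β k := by
  have := weightedCoeff_nonpos_of_le (β := fun i => -β i) hk fun i hi => neg_le_neg (h i hi)
  simpa [weightedCoeff] using this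

/-- The function `∑ a_k β_k w ^ k`, a multiplier transform of `(1 - w) ^ (-1 / 2)`. -/
noncomputable def weightedSeries (β : ℕ → ℝ) (w : ℂ) : ℂ :=
  ∑' k, ((invSqrtCoeff k * β k : ℝ) : ℂ) * w ^ k

/-- The power series of `(1 - w) ^ (1 / 2)`. -/
noncomputable def sqrtSeries (w : ℂ) : ℂ := ∑' k, (sqrtCoeff k : ℂ) * w ^ k

theorem summable_norm_ofReal_mul_pow {c : ℕ → ℝ} {B : ℝ} (hc : ∀ k, |c k| ≤ B) {w : ℂ}
    (hw : ‖w‖ < 1) : Summable fun k => ‖(c k : ℂ) * w ^ k‖ := by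
  refine Summable.of_nonneg_of_le (fun _ => norm_nonneg _) (fun k => ?_)
    ((summable_geometric_of_lt_one (norm_nonneg w) hw).mul_left B)
  rw [norm_mul, norm_pow, Complex.norm_real, Real.norm_eq_abs]
  exact mul_le_mul_of_nonneg_right (hc k) (by positivity)

theorem abs_invSqrtCoeff_mul_le {β : ℕ → ℝ} {B : ℝ} (hβ : ∀ k, |β k| ≤ B) (k : ℕ) :
    |invSqrtCoeff k * β k| ≤ B := by
  rw [abs_mul, abs_of_pos (invSqrtCoeff_pos k)]
  exact (mul_le_of_le_one_left (abs_nonneg _) (invSqrtCoeff_le_one k)).trans (hβ k)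

theorem summable_weightedSeries {β : ℕ → ℝ} {B : ℝ} (hβ : ∀ k, |β k| ≤ B) {w : ℂ}
    (hw : ‖w‖ < 1) : Summable fun k => ‖((invSqrtCoeff k * β k : ℝ) : ℂ) * w ^ k‖ :=
  summable_norm_ofReal_mul_pow (abs_invSqrtCoeff_mul_le hβ) hw

theorem hasSum_ofReal_mul_pow_mul {c d : ℕ → ℝ} {B D : ℝ} (hc : ∀ k, |c k| ≤ B)
    (hd : ∀ k, |d k| ≤ D) {w : ℂ} (hw : ‖w‖ < 1) :
    HasSum (fun k => ((∑ ij ∈ antidiagonal k, c ij.1 * d ij.2 : ℝ) : ℂ) * w ^ k)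
      ((∑' k, (c k : ℂ) * w ^ k) * ∑' k, (d k : ℂ) * w ^ k) := by
  have h1 := summable_norm_ofReal_mul_pow hc hw
  have h2 := summable_norm_ofReal_mul_pow hd hw
  rw [tsum_mul_tsum_eq_tsum_sum_antidiagonal_of_summable_norm h1 h2]
  have h3 := (summable_norm_sum_mul_antidiagonal_of_summable_norm h1 h2).of_norm.hasSum
  have h4 : (fun k => ((∑ ij ∈ antidiagonal k, c ij.1 * d ij.2 : ℝ) : ℂ) * w ^ k) =
      fun k => ∑ ij ∈ antidiagonal k, (c ij.1 : ℂ) * w ^ ij.1 * ((d ij.2 : ℂ) * w ^ ij.2) := by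
    funext k
    push_cast
    rw [sum_mul]
    refine sum_congr rfl fun ij hij => ?_
    rw [← HasAntidiagonal.mem_antidiagonal.1 hij, pow_add]; ring
  rw [h4]
  exact h3

theorem hasSum_weightedCoeff {β : ℕ → ℝ} {B : ℝ} (hβ : ∀ k, |β k| ≤ B) {w : ℂ}
    (hw : ‖w‖ < 1) :
    HasSum (fun k => (weightedCoeff β k : ℂ) * w ^ k) (weightedSeries β w * sqrtSeries w) :=
  hasSum_ofReal_mul_pow_mul (abs_invSqrtCoeff_mul_le hβ) abs_sqrtCoeff_le_one hw

theorem weightedSeries_one_mul_sqrtSeries {w : ℂ} (hw : ‖w‖ < 1) :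
    weightedSeries 1 w * sqrtSeries w = 1 := by
  have h := hasSum_weightedCoeff (β := 1) (B := 1) (fun k => by simp) hw
  have h2 : HasSum (fun k => (weightedCoeff 1 k : ℂ) * w ^ k) 1 := by
    convert hasSum_single (f := fun k => (weightedCoeff 1 k : ℂ) * w ^ k) 0 fun k hk => ?_ using 1
    · simp
    · obtain ⟨k, rfl⟩ := Nat.exists_eq_succ_of_ne_zero hk
      simp [weightedCoeff_succ]
  exact h.unique h2

theorem weightedSeries_one_sq {w : ℂ} (hw : ‖w‖ < 1) :
    weightedSeries 1 w ^ 2 = (1 - w)⁻¹ := by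
  have h1 : ∀ k, |invSqrtCoeff k * (1 : ℕ → ℝ) k| ≤ 1 :=
    abs_invSqrtCoeff_mul_le fun k => by simp
  have h := hasSum_ofReal_mul_pow_mul h1 h1 hw
  simp only [Pi.one_apply, mul_one, sum_antidiagonal_invSqrtCoeff, Complex.ofReal_one,
    one_mul] at h
  rw [sq, weightedSeries]
  simpa using h.unique (hasSum_geometric_of_norm_lt_one hw)

theorem sqrtSeries_sq {w : ℂ} (hw : ‖w‖ < 1) : sqrtSeries w ^ 2 = 1 - w := by
  have h1 := weightedSeries_one_mul_sqrtSeries hw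
  have h2 := weightedSeries_one_sq hw
  have h3 : (1 - w) ≠ 0 := by
    rintro h
    rw [sub_eq_zero] at h
    simp [← h] at hw
  have h4 : (weightedSeries 1 w * sqrtSeries w) ^ 2 = 1 := by rw [h1]; simp
  rw [mul_pow, h2] at h4
  field_simp at h4
  exact h4

theorem sqrtSeries_ne_zero {w : ℂ} (hw : ‖w‖ < 1) : sqrtSeries w ≠ 0 :=
  right_ne_zero_of_mul_eq_one (weightedSeries_one_mul_sqrtSeries hw)

theorem weightedSeries_ofReal (β : ℕ → ℝ) (r : ℝ) :
    weightedSeries β r = ((∑' k, invSqrtCoeff k * β k * r ^ k : ℝ) : ℂ) := by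
  rw [weightedSeries, Complex.ofReal_tsum]
  push_cast
  rfl

/-- The square determines the value up to sign; the reciprocal series has nonnegative terms, which
selects the positive root. -/
theorem sqrtSeries_ofReal {r : ℝ} (h0 : 0 ≤ r) (h1 : r < 1) :
    sqrtSeries r = (√(1 - r) : ℝ) := by
  have hr : ‖(r : ℂ)‖ < 1 := by rwa [Complex.norm_real, Real.norm_of_nonneg h0]
  have hG : sqrtSeries r = ((∑' k, sqrtCoeff k * r ^ k : ℝ) : ℂ) := by
    rw [sqrtSeries, Complex.ofReal_tsum]
    push_cast
    rfl
  have h2 := weightedSeries_one_mul_sqrtSeries hr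
  have h3 := sqrtSeries_sq hr
  rw [weightedSeries_ofReal, hG] at h2
  rw [hG] at h3 ⊢
  norm_cast at h2 h3 ⊢
  have hpos : 0 ≤ ∑' k, invSqrtCoeff k * (1 : ℕ → ℝ) k * r ^ k :=
    tsum_nonneg fun k => by have := invSqrtCoeff_pos k; simp only [Pi.one_apply]; positivity
  rw [← h3, Real.sqrt_sq]
  by_contra! hneg
  linarith [mul_nonpos_of_nonneg_of_nonpos hpos hneg.le]

theorem tsum_invSqrtCoeff {r : ℝ} (h0 : 0 ≤ r) (h1 : r < 1) :
    (∑' k, invSqrtCoeff k * r ^ k) * √(1 - r) = 1 := by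
  have hr : ‖(r : ℂ)‖ < 1 := by rwa [Complex.norm_real, Real.norm_of_nonneg h0]
  have h2 := weightedSeries_one_mul_sqrtSeries hr
  rw [weightedSeries_ofReal, sqrtSeries_ofReal h0 h1] at h2
  norm_cast at h2
  simpa using h2

theorem hasSum_weightedCoeff_real {β : ℕ → ℝ} {B : ℝ} (hβ : ∀ k, |β k| ≤ B) {r : ℝ}
    (h0 : 0 ≤ r) (h1 : r < 1) :
    HasSum (fun k => weightedCoeff β k * r ^ k)
      ((∑' k, invSqrtCoeff k * β k * r ^ k) * √(1 - r)) := by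
  have hr : ‖(r : ℂ)‖ < 1 := by rwa [Complex.norm_real, Real.norm_of_nonneg h0]
  have h2 := hasSum_weightedCoeff hβ hr
  rw [weightedSeries_ofReal, sqrtSeries_ofReal h0 h1] at h2
  exact_mod_cast h2

/-! ### Uniform upper and lower bounds from the sign patterns -/

/-- All coefficients after `β 0` are nonpositive, so their absolute values at radius `‖w‖` sum to `β
0` minus the nonnegative value of the product at `‖w‖`. -/
theorem norm_weightedSeries_mul_sqrtSeries_le {β : ℕ → ℝ} (hanti : Antitone β)
    (hpos : ∀ k, 0 ≤ β k) {w : ℂ} (hw : ‖w‖ < 1) :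
    ‖weightedSeries β w * sqrtSeries w‖ ≤ 2 * β 0 := by
  have hβ : ∀ k, |β k| ≤ β 0 := fun k => by
    rw [abs_of_nonneg (hpos k)]; exact hanti (Nat.zero_le k)
  have h1 := (hasSum_nat_add_iff' 1).2 (hasSum_weightedCoeff hβ hw)
  have h2 := ((hasSum_nat_add_iff' 1).2
    (hasSum_weightedCoeff_real hβ (norm_nonneg w) hw)).neg
  have h3 := h1.norm_le_of_bounded h2 fun k => by
    rw [norm_mul, norm_pow, Complex.norm_real, Real.norm_eq_abs,
      abs_of_nonpos (weightedCoeff_nonpos_of_le k.succ_ne_zero fun i hi => hanti hi), neg_mul]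
  have h4 : 0 ≤ (∑' k, invSqrtCoeff k * β k * ‖w‖ ^ k) * √(1 - ‖w‖) :=
    mul_nonneg (tsum_nonneg fun k => mul_nonneg
      (mul_nonneg (invSqrtCoeff_pos k).le (hpos k)) (by positivity)) (Real.sqrt_nonneg _)
  simp only [sum_range_one, weightedCoeff_zero, pow_zero, mul_one] at h3
  have h5 := norm_add_le (weightedSeries β w * sqrtSeries w - (β 0 : ℂ)) (β 0 : ℂ)
  rw [sub_add_cancel, Complex.norm_real, Real.norm_of_nonneg (hpos 0)] at h5
  linarith

/-- Coefficients are nonnegative in degrees `1` to `n` and nonpositive beyond. Their absolute sum is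
the value at `‖w‖` minus `β 0`, plus twice the tail beyond `n`; the tail coefficients are
differences of `s`, so it telescopes to at most `‖w‖ ^ n * s n`. -/
theorem le_norm_weightedSeries_mul_sqrtSeries {β : ℕ → ℝ} {n : ℕ} (hpos : ∀ k, 0 ≤ β k)
    (hmono : ∀ i j, i ≤ j → j ≤ n → β i ≤ β j) (hzero : ∀ k, n < k → β k = 0)
    {w : ℂ} (hw : ‖w‖ < 1) :
    2 * β 0 - (∑' k, invSqrtCoeff k * β k * ‖w‖ ^ k) * √(1 - ‖w‖)
        - 2 * (‖w‖ ^ n * ∑ ij ∈ antidiagonal n, invSqrtCoeff ij.1 * β ij.1 * invSqrtCoeff ij.2)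
      ≤ ‖weightedSeries β w * sqrtSeries w‖ := by
  set r := ‖w‖ with hr
  have hr0 : 0 ≤ r := norm_nonneg w
  set s : ℕ → ℝ := fun m =>
    ∑ ij ∈ antidiagonal m, invSqrtCoeff ij.1 * β ij.1 * invSqrtCoeff ij.2 with hs
  have hs0 : ∀ m, 0 ≤ s m := fun m => sum_nonneg fun ij _ =>
    mul_nonneg (mul_nonneg (invSqrtCoeff_pos _).le (hpos _)) (invSqrtCoeff_pos _).le
  have hsucc : ∀ k, weightedCoeff β (k + 1) = s (k + 1) - s k := fun k =>
    sum_antidiagonal_mul_sqrtCoeff (fun i => invSqrtCoeff i * β i) k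
  have hneg : ∀ k, n ≤ k → weightedCoeff β (k + 1) ≤ 0 := fun k hk =>
    weightedCoeff_nonpos_of_le k.succ_ne_zero fun i _ => by
      rw [hzero (k + 1) (by omega)]; exact hpos i
  have hnn : ∀ k, k < n → 0 ≤ weightedCoeff β (k + 1) := fun k hk =>
    weightedCoeff_nonneg_of_le k.succ_ne_zero fun i hi => hmono i _ hi hk
  have hβ : ∀ k, |β k| ≤ β n := fun k => by
    rw [abs_of_nonneg (hpos k)]
    rcases le_or_gt k n with h | h
    · exact hmono k n h le_rfl
    · rw [hzero k h]; exact hpos n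
  -- Adding `2 φ` turns the signed series at `r` into the series of absolute values.
  set φ : ℕ → ℝ := fun k => if n ≤ k then -(weightedCoeff β (k + 1) * r ^ (k + 1)) else 0 with hφ
  have hφ0 : ∀ k, 0 ≤ φ k := fun k => by
    simp only [hφ]
    split_ifs with h
    · have := hneg k h
      have : 0 ≤ r ^ (k + 1) := by positivity
      nlinarith
    · exact le_rfl
  -- The truncation `max n k` makes the bound telescope from index `0` with no contribution before
  -- `n`.
  have hφle : ∀ k, φ k ≤ r ^ n * (s (max n k) - s (max n (k + 1))) := fun k => by
    simp only [hφ]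
    split_ifs with h
    · rw [max_eq_right h, max_eq_right (h.trans k.le_succ), ← neg_sub, ← hsucc, ← neg_mul,
        mul_comm]
      exact mul_le_mul_of_nonneg_right (pow_le_pow_of_le_one hr0 hw.le (by omega))
        (neg_nonneg.2 (hneg k h))
    · rw [max_eq_left (by omega), max_eq_left (by omega), sub_self, mul_zero]
  have hφsum : ∀ N, ∑ k ∈ range N, φ k ≤ r ^ n * s n := fun N => by
    refine (sum_le_sum fun k _ => hφle k).trans ?_
    rw [← mul_sum, sum_range_sub' fun k => s (max n k), Nat.max_zero]
    have := hs0 (max n N)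
    exact mul_le_mul_of_nonneg_left (by linarith) (by positivity)
  have hφs : Summable φ := summable_of_sum_range_le hφ0 hφsum
  have hφt : ∑' k, φ k ≤ r ^ n * s n := Real.tsum_le_of_sum_range_le hφ0 hφsum
  have h1 := (hasSum_nat_add_iff' 1).2 (hasSum_weightedCoeff hβ hw)
  have h2 := ((hasSum_nat_add_iff' 1).2
    (hasSum_weightedCoeff_real hβ hr0 hw)).add (hφs.hasSum.mul_left 2)
  have h3 := h1.norm_le_of_bounded h2 fun k => by
    rw [norm_mul, norm_pow, Complex.norm_real, Real.norm_eq_abs, ← hr]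
    simp only [hφ]
    split_ifs with h
    · rw [abs_of_nonpos (hneg k h)]; linarith
    · rw [abs_of_nonneg (hnn k (by omega))]; linarith
  simp only [sum_range_one, weightedCoeff_zero, pow_zero, mul_one] at h3
  have h5 := norm_sub_norm_le (β 0 : ℂ) ((β 0 : ℂ) - weightedSeries β w * sqrtSeries w)
  rw [sub_sub_cancel, Complex.norm_real, Real.norm_of_nonneg (hpos 0), norm_sub_rev] at h5
  linarith

/-! ### The two series attached to `P_n` and `Q_n` -/

/-- The polynomial `∑_{i + j = n} a_i a_j w ^ i`, that is `t ^ n P_n((t + 1 / t) / 2)` with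
`w = t ^ 2`. -/
noncomputable def legendrePAux (n : ℕ) (w : ℂ) : ℂ :=
  ∑ ij ∈ antidiagonal n, (invSqrtCoeff ij.1 : ℂ) * w ^ ij.1 * (invSqrtCoeff ij.2 : ℂ)

theorem norm_legendrePAux_ge {n : ℕ} {w : ℂ} (hw : ‖w‖ < 1) :
    2 * invSqrtCoeff n
        - (∑ ij ∈ antidiagonal n, invSqrtCoeff ij.1 * invSqrtCoeff ij.2 * ‖w‖ ^ ij.1) * √(1 - ‖w‖)
        - 2 * (‖w‖ ^ n * ∑ ij ∈ antidiagonal n, invSqrtCoeff ij.1 * invSqrtCoeff ij.2 ^ 2)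
      ≤ ‖legendrePAux n w * sqrtSeries w‖ := by
  set β : ℕ → ℝ := fun k => if k ≤ n then invSqrtCoeff (n - k) else 0 with hβ
  have h := le_norm_weightedSeries_mul_sqrtSeries (β := β) (n := n)
    (fun k => by simp only [hβ]; split_ifs; exacts [(invSqrtCoeff_pos _).le, le_rfl])
    (fun i j hij hj => by
      simp only [hβ, hj, hij.trans hj, if_true]
      exact invSqrtCoeff_antitone (by omega))
    (fun k hk => by simp [hβ, hk.not_ge]) hw
  have key : ∀ ij ∈ antidiagonal n, β ij.1 = invSqrtCoeff ij.2 := fun ij hij => by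
    rw [HasAntidiagonal.mem_antidiagonal] at hij
    simp only [hβ, ← hij, Nat.le_add_right, if_true, Nat.add_sub_cancel_left]
  have h1 : weightedSeries β w = legendrePAux n w := by
    rw [weightedSeries, tsum_eq_sum (s := range (n + 1)), legendrePAux,
      ← Finset.Nat.sum_antidiagonal_eq_sum_range_succ_mk
        (fun ij : ℕ × ℕ => ((invSqrtCoeff ij.1 * β ij.1 : ℝ) : ℂ) * w ^ ij.1)]
    · refine sum_congr rfl fun ij hij => ?_
      rw [key ij hij]; push_cast; ring
    · intro k hk
      have : ¬ k ≤ n := by simpa [Nat.lt_succ_iff] using hk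
      simp [hβ, this]
  have h2 : ∑' k, invSqrtCoeff k * β k * ‖w‖ ^ k
      = ∑ ij ∈ antidiagonal n, invSqrtCoeff ij.1 * invSqrtCoeff ij.2 * ‖w‖ ^ ij.1 := by
    rw [tsum_eq_sum (s := range (n + 1)),
      ← Finset.Nat.sum_antidiagonal_eq_sum_range_succ_mk
        (fun ij : ℕ × ℕ => invSqrtCoeff ij.1 * β ij.1 * ‖w‖ ^ ij.1)]
    · refine sum_congr rfl fun ij hij => ?_
      rw [key ij hij]
    · intro k hk
      have : ¬ k ≤ n := by simpa [Nat.lt_succ_iff] using hk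
      simp [hβ, this]
  have h3 : ∑ ij ∈ antidiagonal n, invSqrtCoeff ij.1 * β ij.1 * invSqrtCoeff ij.2
      = ∑ ij ∈ antidiagonal n, invSqrtCoeff ij.1 * invSqrtCoeff ij.2 ^ 2 :=
    sum_congr rfl fun ij hij => by rw [key ij hij]; ring
  have h4 : β 0 = invSqrtCoeff n := by simp [hβ]
  rwa [h1, h2, h3, h4] at h

/-- The coefficients `2 / ((2j + 1) a_j) = √π Γ(j + 1) / Γ(j + 3 / 2)`. -/
noncomputable def secondKindCoeff (j : ℕ) : ℝ := 2 / ((2 * j + 1) * invSqrtCoeff j)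

theorem secondKindCoeff_pos (j : ℕ) : 0 < secondKindCoeff j := by
  have := invSqrtCoeff_pos j
  rw [secondKindCoeff]; positivity

theorem secondKindCoeff_succ (j : ℕ) :
    ((j : ℝ) + 3 / 2) * secondKindCoeff (j + 1) = (j + 1) * secondKindCoeff j := by
  have h := invSqrtCoeff_pos j
  rw [secondKindCoeff, secondKindCoeff, invSqrtCoeff]
  push_cast
  field_simp
  ring

theorem secondKindCoeff_antitone : Antitone secondKindCoeff := by
  refine antitone_nat_of_succ_le fun j => ?_
  have h := secondKindCoeff_succ j
  have h2 := secondKindCoeff_pos (j + 1)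
  have h3 : (0 : ℝ) < j + 1 := by positivity
  refine le_of_mul_le_mul_left ?_ h3
  nlinarith

theorem secondKindCoeff_le (n : ℕ) : secondKindCoeff n ≤ 4 * invSqrtCoeff n := by
  have h := invSqrtCoeff_pos n
  have h1 := one_le_invSqrtCoeff_sq n
  rw [secondKindCoeff, div_le_iff₀ (by positivity)]
  have : (0 : ℝ) ≤ n := by positivity
  nlinarith [sq_nonneg (invSqrtCoeff n)]

/-- The series `∑ a_k b_{n + k} w ^ k`, that is `t ^ (-n - 1) Q_n((t + 1 / t) / 2)` with
`w = t ^ 2`. -/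
noncomputable def legendreQAux (n : ℕ) (w : ℂ) : ℂ :=
  weightedSeries (fun k => secondKindCoeff (n + k)) w

theorem norm_legendreQAux_le (n : ℕ) {w : ℂ} (hw : ‖w‖ < 1) :
    ‖legendreQAux n w * sqrtSeries w‖ ≤ 8 * invSqrtCoeff n := by
  have h := norm_weightedSeries_mul_sqrtSeries_le (β := fun k => secondKindCoeff (n + k))
    (fun i j hij => secondKindCoeff_antitone (by omega)) (fun k => (secondKindCoeff_pos _).le) hw
  have h2 := secondKindCoeff_le n
  rw [add_zero] at h
  rw [legendreQAux]
  linarith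

/-! ### Recurrence for `P_n` from the Rodrigues formula -/

section Rodrigues

open Polynomial

/-- With `W = X² - 1`, differentiate `W^(n+2)` once and use Leibniz, or differentiate it twice
directly. Both results contain the `n`-th derivative of `W^(n+1)`; eliminating it leaves the
recurrence. -/
theorem rodrigues_three_term (n : ℕ) :
    derivative^[n + 2] ((X ^ 2 - 1 : ℂ[X]) ^ (n + 2))
      = C (2 * (2 * (n : ℂ) + 3)) * (X * derivative^[n + 1] ((X ^ 2 - 1) ^ (n + 1)))
        - C (4 * ((n : ℂ) + 1) ^ 2) * derivative^[n] ((X ^ 2 - 1) ^ n) := by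
  set W : ℂ[X] := X ^ 2 - 1 with hW
  have hW' : derivative W = C 2 * X := by
    simp only [hW, derivative_sub, derivative_X_pow, derivative_one, sub_zero]; simp
  have hd : ∀ m : ℕ, derivative (W ^ (m + 1)) = C (2 * ((m : ℂ) + 1)) * (W ^ m * X) := by
    intro m
    rw [derivative_pow, hW']
    simp only [Nat.add_sub_cancel, map_mul, map_add, map_natCast, Nat.cast_add, Nat.cast_one,
      map_one]
    ring
  have h1 : derivative^[n + 2] (W ^ (n + 2)) = C (2 * ((n : ℂ) + 2)) *
      (derivative^[n + 1] (W ^ (n + 1)) * X + C ((n : ℂ) + 1) * derivative^[n] (W ^ (n + 1))) := by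
    rw [Function.iterate_succ_apply, hd (n + 1), iterate_derivative_C_mul,
      iterate_derivative_mul_X]
    simp only [nsmul_eq_mul, Nat.add_sub_cancel, map_mul, map_add, map_natCast, Nat.cast_add,
      Nat.cast_one, map_one]
    ring_nf
    simp only [map_ofNat]
    ring
  have h2 : derivative^[n + 2] (W ^ (n + 2)) =
      C (2 * ((n : ℂ) + 2) * (2 * n + 3)) * derivative^[n] (W ^ (n + 1))
        + C (4 * ((n : ℂ) + 2) * (n + 1)) * derivative^[n] (W ^ n) := by
    have hdd : derivative (derivative (W ^ (n + 2))) =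
        C (2 * ((n : ℂ) + 2) * (2 * n + 3)) * W ^ (n + 1)
          + C (4 * ((n : ℂ) + 2) * (n + 1)) * W ^ n := by
      have hX : (X : ℂ[X]) ^ 2 = W + 1 := by rw [hW]; ring
      rw [hd (n + 1), derivative_C_mul, derivative_mul, hd n, derivative_X]
      have : C (2 * ((n : ℂ) + 1)) * (W ^ n * X) * X
          = C (2 * ((n : ℂ) + 1)) * (W ^ n * (W + 1)) := by rw [← hX]; ring
      rw [this]
      simp only [map_mul, map_add, map_natCast, Nat.cast_add, Nat.cast_one, map_one, map_ofNat]
      ring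
    rw [Function.iterate_succ_apply, Function.iterate_succ_apply, hdd, iterate_map_add,
      iterate_derivative_C_mul, iterate_derivative_C_mul]
  have hc : C ((n : ℂ) + 2) ≠ 0 := by
    rw [Ne, C_eq_zero]
    exact_mod_cast (by omega : n + 2 ≠ 0)
  apply mul_left_cancel₀ hc
  simp only [map_mul, map_add, map_natCast, map_one, map_ofNat, map_pow] at h1 h2 ⊢
  linear_combination (2 * (n : ℂ[X]) + 3) * h1 - ((n : ℂ[X]) + 1) * h2

theorem legendreP_zero : legendreP 0 = 1 := by simp [legendreP]

theorem legendreP_one : legendreP 1 = X := by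
  simp only [legendreP, Function.iterate_one, pow_one, Nat.factorial_one, Nat.cast_one, mul_one,
    derivative_sub, derivative_X_pow, derivative_one, sub_zero, Nat.cast_ofNat]
  rw [← mul_assoc, ← C_mul]
  norm_num

theorem legendreP_three_term (n : ℕ) :
    C ((n : ℂ) + 2) * legendreP (n + 2)
      = C (2 * (n : ℂ) + 3) * (X * legendreP (n + 1)) - C ((n : ℂ) + 1) * legendreP n := by
  have hf : (n.factorial : ℂ) ≠ 0 := by exact_mod_cast n.factorial_ne_zero
  have h1 : (n : ℂ) + 1 ≠ 0 := by exact_mod_cast n.succ_ne_zero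
  have h2 : (n : ℂ) + 2 ≠ 0 := by exact_mod_cast (by omega : n + 2 ≠ 0)
  have h3 : (n : ℂ) + 1 + 1 ≠ 0 := by exact_mod_cast (by omega : n + 1 + 1 ≠ 0)
  have e1 := congrArg C (show ((n : ℂ) + 2) * (1 / (2 ^ (n + 2) * ((n + 2).factorial : ℂ)))
      * (2 * (2 * (n : ℂ) + 3)) = (2 * n + 3) * (1 / (2 ^ (n + 1) * ((n + 1).factorial : ℂ))) by
    simp only [Nat.factorial_succ, pow_succ]
    push_cast
    field_simp
    ring)
  have e2 := congrArg C (show ((n : ℂ) + 2) * (1 / (2 ^ (n + 2) * ((n + 2).factorial : ℂ)))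
      * (4 * ((n : ℂ) + 1) ^ 2) = (n + 1) * (1 / (2 ^ n * (n.factorial : ℂ))) by
    simp only [Nat.factorial_succ, pow_succ]
    push_cast
    field_simp
    ring)
  simp only [legendreP]
  rw [rodrigues_three_term]
  simp only [C_mul] at e1 e2 ⊢
  linear_combination (X * derivative^[n + 1] ((X ^ 2 - 1) ^ (n + 1))) * e1
    - derivative^[n] ((X ^ 2 - 1) ^ n) * e2

theorem legendreP_eval_three_term (n : ℕ) (z : ℂ) :
    ((n : ℂ) + 2) * (legendreP (n + 2)).eval z
      = (2 * n + 3) * (z * (legendreP (n + 1)).eval z) - (n + 1) * (legendreP n).eval z := by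
  have h := congrArg (eval z) (legendreP_three_term n)
  simpa only [eval_mul, eval_sub, eval_C, eval_X] using h

theorem continuous_legendreP_eval (n : ℕ) :
    Continuous fun x : ℝ => (legendreP n).eval (x : ℂ) :=
  (legendreP n).continuous.comp Complex.continuous_ofReal

/-- The antiderivative still contains a factor `X² - 1`, so it vanishes at both endpoints. This
removes the inhomogeneous term from the recurrence for `Q_n`. -/
theorem integral_legendreP_succ (n : ℕ) :
    ∫ x in (-1 : ℝ)..1, (legendreP (n + 1)).eval (x : ℂ) = 0 := by
  set F : ℂ[X] := C (1 / (2 ^ (n + 1) * ((n + 1).factorial : ℂ))) *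
    derivative^[n] ((X ^ 2 - 1) ^ (n + 1)) with hF
  have hFd : derivative F = legendreP (n + 1) := by
    rw [hF, derivative_C_mul, legendreP, Function.iterate_succ_apply']
  have hdvd : (X ^ 2 - 1 : ℂ[X]) ∣ derivative^[n] ((X ^ 2 - 1) ^ (n + 1)) := by
    simpa using pow_sub_dvd_iterate_derivative_pow (X ^ 2 - 1 : ℂ[X]) (n + 1) n
  have hz : ∀ c : ℂ, c ^ 2 = 1 → F.eval c = 0 := by
    intro c hc
    obtain ⟨q, hq⟩ := hdvd
    rw [hF, hq]
    simp [hc]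
  rw [intervalIntegral.integral_eq_sub_of_hasDerivAt (f := fun x : ℝ => F.eval (x : ℂ))]
  · rw [hz _ (by simp), hz _ (by simp), sub_zero]
  · intro x _
    rw [← hFd]
    exact (F.hasDerivAt (x : ℂ)).comp_ofReal
  · exact (continuous_legendreP_eval (n + 1)).intervalIntegrable _ _

end Rodrigues

/-! ### Recurrence for `Q_n` -/

section SecondKind

variable {z : ℂ}

theorem intervalIntegrable_div_sub (hz : ∀ x ∈ Set.Icc (-1 : ℝ) 1, z - (x : ℂ) ≠ 0) {f : ℝ → ℂ}
    (hf : Continuous f) :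
    IntervalIntegrable (fun x : ℝ => f x / (z - (x : ℂ))) MeasureTheory.volume (-1) 1 := by
  apply ContinuousOn.intervalIntegrable
  rw [Set.uIcc_of_le (by norm_num)]
  exact hf.continuousOn.div (by fun_prop) hz

theorem integral_mul_div_sub (hz : ∀ x ∈ Set.Icc (-1 : ℝ) 1, z - (x : ℂ) ≠ 0) {f : ℝ → ℂ}
    (hf : Continuous f) :
    ∫ x in (-1 : ℝ)..1, (x : ℂ) * f x / (z - (x : ℂ))
      = z * (∫ x in (-1 : ℝ)..1, f x / (z - (x : ℂ))) - ∫ x in (-1 : ℝ)..1, f x := by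
  rw [← intervalIntegral.integral_const_mul, ← intervalIntegral.integral_sub
    ((intervalIntegrable_div_sub hz hf).const_mul z) (hf.intervalIntegrable _ _)]
  refine intervalIntegral.integral_congr fun x hx => ?_
  rw [Set.uIcc_of_le (by norm_num)] at hx
  have := hz x hx
  field_simp
  ring

theorem legendreQ_three_term (hz : ∀ x ∈ Set.Icc (-1 : ℝ) 1, z - (x : ℂ) ≠ 0) (n : ℕ) :
    ((n : ℂ) + 2) * legendreQ (n + 2) z
      = (2 * n + 3) * (z * legendreQ (n + 1) z) - (n + 1) * legendreQ n z := by
  have hc := continuous_legendreP_eval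
  have h1 := integral_mul_div_sub hz (hc (n + 1))
  rw [integral_legendreP_succ, sub_zero] at h1
  have h2 : ((n : ℂ) + 2) * ∫ x in (-1 : ℝ)..1, (legendreP (n + 2)).eval (x : ℂ) / (z - (x : ℂ))
      = (2 * n + 3) * (∫ x in (-1 : ℝ)..1,
          (x : ℂ) * (legendreP (n + 1)).eval (x : ℂ) / (z - (x : ℂ)))
        - (n + 1) * ∫ x in (-1 : ℝ)..1, (legendreP n).eval (x : ℂ) / (z - (x : ℂ)) := by
    have hx : Continuous fun x : ℝ => (x : ℂ) * (legendreP (n + 1)).eval (x : ℂ) :=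
      Complex.continuous_ofReal.mul (hc (n + 1))
    rw [← intervalIntegral.integral_const_mul, ← intervalIntegral.integral_const_mul,
      ← intervalIntegral.integral_const_mul, ← intervalIntegral.integral_sub
        ((intervalIntegrable_div_sub hz hx).const_mul _)
        ((intervalIntegrable_div_sub hz (hc n)).const_mul _)]
    refine intervalIntegral.integral_congr fun x _ => ?_
    have := legendreP_eval_three_term n x
    linear_combination (1 / (z - (x : ℂ))) * this
  simp only [legendreQ]
  linear_combination (1 / 2) * h2 + (1 / 2) * (2 * (n : ℂ) + 3) * h1

theorem legendreQ_one (hz : ∀ x ∈ Set.Icc (-1 : ℝ) 1, z - (x : ℂ) ≠ 0) :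
    legendreQ 1 z = z * legendreQ 0 z - 1 := by
  have h1 := integral_mul_div_sub hz (continuous_const (y := (1 : ℂ)))
  simp only [legendreQ, legendreP_zero, legendreP_one, Polynomial.eval_X, Polynomial.eval_one]
  simp only [mul_one] at h1
  rw [h1]
  simp
  ring

end SecondKind

/-! ### Joukowski coordinates and `Q_0` -/

section Joukowski

variable {t z : ℂ}

theorem one_sub_two_mul_cos (t : ℂ) (θ : ℝ) :
    1 - 2 * t * Complex.cos θ + t ^ 2
      = (1 - t * Complex.exp (θ * Complex.I)) * (1 - t * Complex.exp (-θ * Complex.I)) := by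
  have h : Complex.exp (θ * Complex.I) * Complex.exp (-θ * Complex.I) = 1 := by
    rw [← Complex.exp_add]; simp
  rw [Complex.cos]
  linear_combination -t ^ 2 * h

theorem one_sub_mul_exp_mem_slitPlane (ht : ‖t‖ < 1) (θ : ℝ) :
    1 - t * Complex.exp (θ * Complex.I) ∈ Complex.slitPlane := by
  rw [sub_eq_add_neg]
  apply Complex.mem_slitPlane_of_norm_lt_one
  rw [norm_neg, norm_mul, Complex.norm_exp_ofReal_mul_I, mul_one]
  exact ht

theorem one_sub_two_mul_cos_ne_zero (ht : ‖t‖ < 1) (θ : ℝ) :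
    1 - 2 * t * Complex.cos θ + t ^ 2 ≠ 0 := by
  rw [one_sub_two_mul_cos]
  have h := one_sub_mul_exp_mem_slitPlane ht (-θ)
  push_cast at h
  exact mul_ne_zero (Complex.slitPlane_ne_zero (one_sub_mul_exp_mem_slitPlane ht θ))
    (Complex.slitPlane_ne_zero h)

theorem joukowski_sub_ne_zero (ht : ‖t‖ < 1) (hz : 2 * t * z = 1 + t ^ 2) (x : ℝ)
    (hx : x ∈ Set.Icc (-1 : ℝ) 1) : z - (x : ℂ) ≠ 0 := by
  have h := one_sub_two_mul_cos_ne_zero ht (Real.arccos x)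
  rw [← Complex.ofReal_cos, Real.cos_arccos hx.1 hx.2] at h
  intro h0
  apply h
  linear_combination -hz + 2 * t * h0

/-- Under `x = cos θ` the denominator factors as `(1 - t e^{iθ})(1 - t e^{-iθ})`. Both factors stay
in the slit plane, so principal logarithms give a global antiderivative with no branch tracking. -/
theorem legendreQ_zero_eq_log (ht : ‖t‖ < 1) (hz : 2 * t * z = 1 + t ^ 2) :
    legendreQ 0 z = Complex.log (1 + t) - Complex.log (1 - t) := by
  have ht0 : t ≠ 0 := by rintro rfl; simp at hz
  set g : ℝ → ℂ := fun x => 1 / (z - (x : ℂ)) with hg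
  have hgc : ContinuousOn g (Set.Icc (-1) 1) :=
    continuousOn_const.div (by fun_prop) (joukowski_sub_ne_zero ht hz)
  have hsub := intervalIntegral.integral_deriv_smul_comp' (a := Real.pi) (b := 0)
    (f := Real.cos) (f' := fun θ => -Real.sin θ) (g := g)
    (fun θ _ => Real.hasDerivAt_cos θ) (by fun_prop)
    (hgc.mono (by rintro _ ⟨θ, _, rfl⟩; exact Real.cos_mem_Icc θ))
  rw [Real.cos_pi, Real.cos_zero] at hsub
  set L : ℝ → ℂ := fun θ => Complex.log (1 - t * Complex.exp (θ * Complex.I))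
    + Complex.log (1 - t * Complex.exp (-θ * Complex.I)) with hL
  have hLd : ∀ θ : ℝ, HasDerivAt (fun θ => -L θ) ((-Real.sin θ) • (g ∘ Real.cos) θ) θ := by
    intro θ
    have h1 : HasDerivAt (fun θ : ℝ => 1 - t * Complex.exp (θ * Complex.I))
        (-(t * (Complex.exp (θ * Complex.I) * Complex.I))) θ := by
      have := (((Complex.ofRealCLM.hasDerivAt (x := θ)).mul_const Complex.I).cexp.const_mul
        t).const_sub 1
      simpa using this
    have h2 : HasDerivAt (fun θ : ℝ => 1 - t * Complex.exp (-θ * Complex.I))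
        (-(t * (Complex.exp (-θ * Complex.I) * (-Complex.I)))) θ := by
      have := (((Complex.ofRealCLM.hasDerivAt (x := θ)).neg.mul_const Complex.I).cexp.const_mul
        t).const_sub 1
      simpa using this
    have s1 := one_sub_mul_exp_mem_slitPlane ht θ
    have s2 := one_sub_mul_exp_mem_slitPlane ht (-θ)
    push_cast at s2
    have h3 := ((h1.clog_real s1).add (h2.clog_real s2)).neg
    refine h3.congr_deriv ?_
    have n1 := Complex.slitPlane_ne_zero s1
    have n2 := Complex.slitPlane_ne_zero s2
    have n3 := one_sub_two_mul_cos_ne_zero ht θ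
    have hgx : g (Real.cos θ) = 2 * t / (1 - 2 * t * Complex.cos θ + t ^ 2) := by
      have := joukowski_sub_ne_zero ht hz _ (Real.cos_mem_Icc θ)
      simp only [hg]
      rw [div_eq_div_iff this n3]
      push_cast
      linear_combination -hz
    rw [Function.comp, hgx, one_sub_two_mul_cos, Complex.real_smul, Complex.ofReal_neg,
      Complex.ofReal_sin, Complex.sin, div_add_div _ _ n1 n2, ← neg_div, mul_div_assoc']
    congr 1
    ring
  have hint := intervalIntegral.integral_eq_sub_of_hasDerivAt
    (fun θ (_ : θ ∈ Set.uIcc Real.pi 0) => hLd θ) (by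
      apply ContinuousOn.intervalIntegrable
      have h1 : ContinuousOn (fun θ : ℝ => -Real.sin θ) (Set.uIcc Real.pi 0) := by fun_prop
      exact h1.smul (hgc.comp (by fun_prop) fun θ _ => Real.cos_mem_Icc θ))
  have hq : legendreQ 0 z = 1 / 2 * ∫ x in (-1 : ℝ)..1, g x := by
    simp [legendreQ, legendreP_zero, hg]
  rw [hq, ← hsub, hint]
  simp only [hL]
  have e1 : Complex.exp (-(Real.pi : ℂ) * Complex.I) = -1 := by
    rw [neg_mul, Complex.exp_neg, Complex.exp_pi_mul_I]; norm_num
  rw [e1, Complex.exp_pi_mul_I]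
  simp
  ring

end Joukowski

/-! ### Identification of `P_n` and `Q_n` with their series -/

theorem hasSum_of_forall_eq {f g : ℕ → ℂ} {a : ℂ} (h : HasSum f a) (e : ∀ k, g k = f k) :
    HasSum g a := by
  rwa [funext e]

theorem hasSum_legendreQAux (n : ℕ) {w : ℂ} (hw : ‖w‖ < 1) :
    HasSum (fun k => ((invSqrtCoeff k * secondKindCoeff (n + k) : ℝ) : ℂ) * w ^ k)
      (legendreQAux n w) :=
  (summable_weightedSeries (β := fun k => secondKindCoeff (n + k)) (B := secondKindCoeff 0)
    (fun k => by
      rw [abs_of_pos (secondKindCoeff_pos _)]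
      exact secondKindCoeff_antitone (Nat.zero_le _)) hw).of_norm.hasSum

theorem hasSum_legendreQAux_succ (n : ℕ) {w : ℂ} (hw : ‖w‖ < 1) :
    HasSum (fun k => ((invSqrtCoeff (k + 1) * secondKindCoeff (n + (k + 1)) : ℝ) : ℂ) * w ^ (k + 1))
      (legendreQAux n w - secondKindCoeff n) := by
  simpa using (hasSum_nat_add_iff' 1).2 (hasSum_legendreQAux n hw)

theorem hasSum_mul_legendreQAux (n : ℕ) {w : ℂ} (hw : ‖w‖ < 1) :
    HasSum (fun k => ((invSqrtCoeff k * secondKindCoeff (n + k) : ℝ) : ℂ) * w ^ (k + 1))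
      (w * legendreQAux n w) :=
  hasSum_of_forall_eq ((hasSum_legendreQAux n hw).mul_left w) fun k => by ring

theorem legendreQAux_three_term (n : ℕ) {w : ℂ} (hw : ‖w‖ < 1) :
    ((n : ℂ) + 2) * (w * legendreQAux (n + 2) w)
      = (n + 3 / 2) * ((1 + w) * legendreQAux (n + 1) w) - (n + 1) * legendreQAux n w := by
  have h1 := (hasSum_mul_legendreQAux (n + 2) hw).mul_left ((n : ℂ) + 2)
  have h2 := (hasSum_legendreQAux_succ (n + 1) hw).mul_left ((n : ℂ) + 3 / 2)
  have h3 := (hasSum_mul_legendreQAux (n + 1) hw).mul_left ((n : ℂ) + 3 / 2)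
  have h4 := (hasSum_legendreQAux_succ n hw).mul_left ((n : ℂ) + 1)
  have h5 := (h2.add h3).sub h4
  have h6 : ((n : ℂ) + 3 / 2) * secondKindCoeff (n + 1) = (n + 1) * secondKindCoeff n := by
    have := congrArg Complex.ofReal (secondKindCoeff_succ n)
    push_cast at this
    exact this
  have hterm : ∀ k : ℕ, ((n : ℝ) + 2) * (invSqrtCoeff k * secondKindCoeff (n + 2 + k))
      = (n + 3 / 2) * (invSqrtCoeff (k + 1) * secondKindCoeff (n + 1 + (k + 1)))
        + (n + 3 / 2) * (invSqrtCoeff k * secondKindCoeff (n + 1 + k))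
        - (n + 1) * (invSqrtCoeff (k + 1) * secondKindCoeff (n + (k + 1))) := by
    intro k
    have e1 : n + 2 + k = n + k + 1 + 1 := by ring
    have e2 : n + 1 + (k + 1) = n + k + 1 + 1 := by ring
    have e3 : n + 1 + k = n + k + 1 := by ring
    have e4 : n + (k + 1) = n + k + 1 := by ring
    rw [e1, e2, e3, e4]
    have hb := secondKindCoeff_succ (n + k + 1)
    have ha := invSqrtCoeff_succ k
    push_cast at hb
    have hb' : secondKindCoeff (n + k + 1 + 1)
        = ((n : ℝ) + k + 2) * secondKindCoeff (n + k + 1) / (n + k + 5 / 2) := by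
      rw [eq_div_iff (by positivity)]; linear_combination hb
    have ha' : invSqrtCoeff (k + 1) = ((k : ℝ) + 1 / 2) * invSqrtCoeff k / (k + 1) := by
      rw [eq_div_iff (by positivity)]; linear_combination ha
    rw [hb', ha']
    field_simp
    ring
  have h7 := h1.unique (hasSum_of_forall_eq h5 fun k => by
    have := congrArg Complex.ofReal (hterm k)
    push_cast at this ⊢
    linear_combination w ^ (k + 1) * this)
  -- The shifted series omit their constant terms; `h6` says these cancel.
  linear_combination h7 - h6

theorem legendreQAux_one {w : ℂ} (hw : ‖w‖ < 1) :
    w * legendreQAux 1 w = 1 / 2 * ((1 + w) * legendreQAux 0 w) - 1 := by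
  have h1 := hasSum_mul_legendreQAux 1 hw
  have h5 := ((hasSum_legendreQAux_succ 0 hw).add (hasSum_mul_legendreQAux 0 hw)).mul_left (1 / 2)
  have hb : secondKindCoeff 0 = 2 := by simp [secondKindCoeff]
  have hterm : ∀ k : ℕ, invSqrtCoeff k * secondKindCoeff (1 + k)
      = 1 / 2 * (invSqrtCoeff (k + 1) * secondKindCoeff (k + 1)
        + invSqrtCoeff k * secondKindCoeff k) := by
    intro k
    have ha' : invSqrtCoeff (k + 1) = ((k : ℝ) + 1 / 2) * invSqrtCoeff k / (k + 1) := by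
      rw [eq_div_iff (by positivity)]; linear_combination invSqrtCoeff_succ k
    have hb' : secondKindCoeff (k + 1) = ((k : ℝ) + 1) * secondKindCoeff k / (k + 3 / 2) := by
      rw [eq_div_iff (by positivity)]; linear_combination secondKindCoeff_succ k
    rw [add_comm 1 k, ha', hb']
    field_simp
    ring
  have h7 := h1.unique (hasSum_of_forall_eq h5 fun k => by
    have := congrArg Complex.ofReal (hterm k)
    rw [zero_add, zero_add]
    push_cast at this ⊢
    linear_combination w ^ (k + 1) * this)
  rw [hb] at h7
  push_cast at h7
  linear_combination h7

/-- Only odd powers survive in `log (1 + t) - log (1 - t)`, with coefficients `2/(2k+1) = a_k b_k`.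
-/
theorem mul_legendreQAux_zero {t : ℂ} (ht : ‖t‖ < 1) :
    t * legendreQAux 0 (t ^ 2) = Complex.log (1 + t) - Complex.log (1 - t) := by
  have hw : ‖t ^ 2‖ < 1 := by rw [norm_pow]; exact pow_lt_one₀ (norm_nonneg t) ht two_ne_zero
  have h1 := (hasSum_legendreQAux 0 hw).mul_left t
  have h2 := (Complex.hasSum_taylorSeries_log ht).add (Complex.hasSum_taylorSeries_neg_log ht)
  rw [← sub_eq_add_neg] at h2
  have hinj : Function.Injective fun k : ℕ => 2 * k + 1 := fun i j h => by simpa using h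
  rw [← hinj.hasSum_iff] at h2
  · refine h1.unique (hasSum_of_forall_eq h2 fun k => ?_)
    have ha := (invSqrtCoeff_pos k).ne'
    have hb : invSqrtCoeff k * secondKindCoeff (0 + k) = 2 / (2 * k + 1) := by
      rw [zero_add, secondKindCoeff]; field_simp
    rw [hb]
    simp only [Function.comp]
    rw [show (-1 : ℂ) ^ (2 * k + 1 + 1) = 1 by
      rw [show 2 * k + 1 + 1 = 2 * (k + 1) by ring, pow_mul]; simp]
    push_cast
    ring
  · intro m hm
    have hev : Even m := by
      rw [← Nat.not_odd_iff_even]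
      rintro ⟨k, rfl⟩
      exact hm ⟨k, rfl⟩
    rw [pow_succ, hev.neg_one_pow]
    ring

theorem norm_sq_lt_one {t : ℂ} (ht : ‖t‖ < 1) : ‖t ^ 2‖ < 1 := by
  rw [norm_pow]; exact pow_lt_one₀ (norm_nonneg t) ht two_ne_zero

theorem legendreQ_eq {t z : ℂ} (ht : ‖t‖ < 1) (hz : 2 * t * z = 1 + t ^ 2) (n : ℕ) :
    legendreQ n z = t ^ (n + 1) * legendreQAux n (t ^ 2) := by
  have ht0 : t ≠ 0 := by rintro rfl; simp at hz
  have hne := joukowski_sub_ne_zero ht hz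
  have hw := norm_sq_lt_one ht
  have h0 : legendreQ 0 z = t ^ (0 + 1) * legendreQAux 0 (t ^ 2) := by
    rw [legendreQ_zero_eq_log ht hz, zero_add, pow_one, mul_legendreQAux_zero ht]
  induction n using Nat.twoStepInduction with
  | zero => exact h0
  | one =>
    rw [legendreQ_one hne, h0]
    linear_combination 1 / 2 * legendreQAux 0 (t ^ 2) * hz - legendreQAux_one hw
  | more n ih0 ih1 =>
    have h2 : (n : ℂ) + 2 ≠ 0 := by exact_mod_cast (by omega : n + 2 ≠ 0)
    apply mul_left_cancel₀ h2
    rw [legendreQ_three_term hne, ih0, ih1]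
    linear_combination -t ^ (n + 1) * legendreQAux_three_term n hw
      + (n + 3 / 2) * t ^ (n + 1) * legendreQAux (n + 1) (t ^ 2) * hz

theorem legendreP_eval_eq {t z : ℂ} (hz : 2 * t * z = 1 + t ^ 2) (n : ℕ) :
    t ^ n * (legendreP n).eval z = legendrePAux n (t ^ 2) := by
  have ha : ∀ i : ℕ, ((i : ℂ) + 1) * invSqrtCoeff (i + 1) = (i + 1 / 2) * invSqrtCoeff i := by
    intro i
    have := congrArg Complex.ofReal (invSqrtCoeff_succ i)
    push_cast at this
    exact this
  induction n using Nat.twoStepInduction with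
  | zero => simp [legendreP_zero, legendrePAux]
  | one =>
    have h1 : invSqrtCoeff 1 = 1 / 2 := by rw [invSqrtCoeff]; norm_num
    simp [legendreP_one, legendrePAux, Finset.Nat.antidiagonal_succ, h1]
    linear_combination 1 / 2 * hz
  | more n ih0 ih1 =>
    have h2 : (n : ℂ) + 2 ≠ 0 := by exact_mod_cast (by omega : n + 2 ≠ 0)
    have h3 := antidiagonal_three_term (x := fun i => (invSqrtCoeff i : ℂ) * (t ^ 2) ^ i)
      (y := fun i => (invSqrtCoeff i : ℂ)) (w := t ^ 2)
      (fun i => by linear_combination (t ^ 2) ^ (i + 1) * ha i) ha n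
    apply mul_left_cancel₀ h2
    change _ = ((n : ℂ) + 2) * ∑ ij ∈ antidiagonal (n + 2), _
    rw [h3]
    change _ = (n + 3 / 2) * (1 + t ^ 2) * legendrePAux (n + 1) (t ^ 2)
      - (n + 1) * t ^ 2 * legendrePAux n (t ^ 2)
    rw [← ih0, ← ih1]
    linear_combination t ^ (n + 2) * legendreP_eval_three_term n z
      + (n + 3 / 2) * t ^ (n + 1) * (legendreP (n + 1)).eval z * hz

/-! ### Reduction to a lower bound for `P_n` -/

/-- If `legendrePAux` obeys its generic lower bound, the ratio `Q_n / P_n` has its generic size. -/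
theorem norm_legendreQ_div_legendreP_le {t z : ℂ} (ht : ‖t‖ < 1) (hz : 2 * t * z = 1 + t ^ 2)
    {n : ℕ} (h : invSqrtCoeff n / 2 ≤ ‖legendrePAux n (t ^ 2) * sqrtSeries (t ^ 2)‖) :
    (legendreP n).eval z ≠ 0 ∧
      ‖legendreQ n z / (legendreP n).eval z‖ ≤ 16 * (‖t‖ ^ 2) ^ n := by
  have ha := invSqrtCoeff_pos n
  have hw := norm_sq_lt_one ht
  have hP : (legendreP n).eval z ≠ 0 := by
    intro h0
    rw [← legendreP_eval_eq hz, h0] at h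
    simp at h
    linarith
  refine ⟨hP, ?_⟩
  have hs := norm_pos_iff.2 (sqrtSeries_ne_zero hw)
  have hQ := norm_legendreQAux_le n hw
  rw [norm_div, div_le_iff₀ (norm_pos_iff.2 hP), legendreQ_eq ht hz]
  rw [← legendreP_eval_eq hz] at h
  simp only [norm_mul, norm_pow] at h hQ ⊢
  have ht0 := norm_nonneg t
  refine le_of_mul_le_mul_right ?_ hs
  calc ‖t‖ ^ (n + 1) * ‖legendreQAux n (t ^ 2)‖ * ‖sqrtSeries (t ^ 2)‖
      ≤ ‖t‖ ^ n * (16 * (invSqrtCoeff n / 2)) := by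
        rw [mul_assoc]
        refine mul_le_mul (pow_le_pow_of_le_one ht0 ht.le n.le_succ) (by linarith)
          (by positivity) (by positivity)
    _ ≤ ‖t‖ ^ n * (16 * (‖t‖ ^ n * ‖(legendreP n).eval z‖ * ‖sqrtSeries (t ^ 2)‖)) := by gcongr
    _ = _ := by ring

theorem sqrtSqSubOne_sq (z : ℂ) : sqrtSqSubOne z ^ 2 = z ^ 2 - 1 := by
  have h : ∀ x : ℂ, (x ^ (1 / 2 : ℂ)) ^ 2 = x := fun x => by
    rw [← Complex.cpow_nat_mul]; norm_num
  rw [sqrtSqSubOne, mul_pow, h, h]; ring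

/-- On a Bernstein ellipse `t = z - √(z ^ 2 - 1)` is the inverse Joukowski image in the disk. -/
theorem exists_joukowski_of_mem_bernsteinEllipse {ρ : ℝ} {z : ℂ}
    (hz : z ∈ bernsteinEllipse ρ) : ∃ t : ℂ, ‖t‖ = ρ⁻¹ ∧ 2 * t * z = 1 + t ^ 2 := by
  have hs := sqrtSqSubOne_sq z
  have hz' : ‖z + sqrtSqSubOne z‖ = ρ := hz
  refine ⟨z - sqrtSqSubOne z, ?_, by linear_combination -hs⟩
  have h1 : ‖z - sqrtSqSubOne z‖ * ‖z + sqrtSqSubOne z‖ = 1 := by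
    rw [← norm_mul, show (z - sqrtSqSubOne z) * (z + sqrtSqSubOne z) = 1 by
      linear_combination -hs, norm_one]
  rw [hz'] at h1
  exact eq_inv_of_mul_eq_one_left h1

/-! ### Error estimates for the lower bound -/

theorem sum_invSqrtCoeff_mul_sq_le (n : ℕ) :
    ∑ ij ∈ antidiagonal n, invSqrtCoeff ij.1 * invSqrtCoeff ij.2 ^ 2
      ≤ 3 * invSqrtCoeff n * (1 + Real.log (n + 1)) := by
  have ha := invSqrtCoeff_pos n
  set h : ℕ → ℝ := fun i => 1 / (2 * (i : ℝ) + 1) with hh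
  have hterm : ∀ ij ∈ antidiagonal n, invSqrtCoeff ij.1 * invSqrtCoeff ij.2 ^ 2
      ≤ 2 * invSqrtCoeff n * (h ij.1 / 2 + h ij.2) := by
    rintro ⟨i, j⟩ hij
    rw [HasAntidiagonal.mem_antidiagonal] at hij
    simp only at hij ⊢
    have hi0 : 0 < h i := by positivity
    have hj0 : 0 < h j := by positivity
    have hsq : ∀ k, invSqrtCoeff k ^ 2 ≤ h k := fun k => by
      rw [hh, le_div_iff₀ (by positivity)]; exact invSqrtCoeff_sq_le k
    -- Partial fractions: this splits the product bound into two harmonic sums, the source of the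
    -- logarithm.
    have hprod : h i * h j * (2 * n + 2) = h i + h j := by
      simp only [hh, ← hij]
      push_cast
      field_simp
      ring
    have hn : 1 ≤ 4 * invSqrtCoeff n ^ 2 * (2 * n + 2) := by
      nlinarith [one_le_invSqrtCoeff_sq n, sq_nonneg (invSqrtCoeff n)]
    refine le_of_sq_le_sq ?_ (by positivity)
    calc (invSqrtCoeff i * invSqrtCoeff j ^ 2) ^ 2
        = invSqrtCoeff i ^ 2 * (invSqrtCoeff j ^ 2 * invSqrtCoeff j ^ 2) := by ring
      _ ≤ h i * (h j * h j) := by gcongr <;> exact hsq _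
      _ ≤ h i * (h j * h j) * (4 * invSqrtCoeff n ^ 2 * (2 * n + 2)) :=
          le_mul_of_one_le_right (by positivity) hn
      _ = 4 * invSqrtCoeff n ^ 2 * ((h i + h j) * h j) := by rw [← hprod]; ring
      _ ≤ 4 * invSqrtCoeff n ^ 2 * (h i / 2 + h j) ^ 2 := by
          gcongr
          nlinarith [sq_nonneg (h i)]
      _ = _ := by ring
  have hH : ∑ i ∈ range (n + 1), h i ≤ 1 + Real.log (n + 1) := by
    have h1 := harmonic_le_one_add_log (n + 1)
    rw [harmonic] at h1
    push_cast at h1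
    refine le_trans (sum_le_sum fun i _ => ?_) h1
    simp only [hh]
    rw [one_div]
    gcongr
    have : (0 : ℝ) ≤ i := by positivity
    linarith
  have e1 : ∑ ij ∈ antidiagonal n, h ij.1 = ∑ i ∈ range (n + 1), h i :=
    Finset.Nat.sum_antidiagonal_eq_sum_range_succ_mk (fun ij : ℕ × ℕ => h ij.1) n
  have e2 : ∑ ij ∈ antidiagonal n, h ij.2 = ∑ i ∈ range (n + 1), h i := by
    rw [← e1, ← Finset.Nat.sum_antidiagonal_swap]; rfl
  refine (sum_le_sum hterm).trans ?_
  rw [← mul_sum, sum_add_distrib, ← sum_div, e1, e2]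
  nlinarith

/-- Truncated form of `2(1 - r) r f' = r f` for `f = (1 - r)^(-1/2)`; it controls the first moment
`∑ k a_k r^k`. -/
theorem sum_mul_invSqrtCoeff_mul_pow (n : ℕ) (r : ℝ) :
    (1 - r) * ∑ k ∈ range (n + 1), (2 * k + 1) * invSqrtCoeff k * r ^ k
        + (2 * n + 1) * invSqrtCoeff n * r ^ (n + 1)
      = ∑ k ∈ range (n + 1), invSqrtCoeff k * r ^ k := by
  induction n with
  | zero => simp
  | succ n ih =>
    rw [sum_range_succ, sum_range_succ _ (n + 1), ← ih]
    have := invSqrtCoeff_succ n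
    push_cast
    linear_combination 2 * r ^ (n + 1) * this

/-- Comparison of the coefficients of `legendrePAux` with those of `(1 - w) ^ (-1 / 2)`. -/
theorem invSqrtCoeff_mul_mul_pow_le {i j n : ℕ} (hn : n ≠ 0) (hij : i + j = n) {τ : ℝ}
    (h0 : 0 ≤ τ) (h1 : τ ≤ 1) :
    invSqrtCoeff i * invSqrtCoeff j * (τ ^ 2) ^ i
      ≤ invSqrtCoeff n * (invSqrtCoeff i * (τ ^ 2) ^ i)
        + invSqrtCoeff n / n * (i * (invSqrtCoeff i * (τ ^ 2) ^ i))
        + 2 * invSqrtCoeff n * τ ^ n * invSqrtCoeff j := by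
  have hi := invSqrtCoeff_pos i
  have hj := invSqrtCoeff_pos j
  have ha := invSqrtCoeff_pos n
  have hn0 : (0 : ℝ) < n := by positivity
  have hijr : (i : ℝ) + j = n := by exact_mod_cast hij
  -- For `i ≤ n/2`, `a_j` is within a factor `1 + i/n` of `a_n`; for larger `i`, the power is
  -- already at most `τ ^ n`.
  rcases le_or_gt (2 * i) n with h | h
  · have hr : 2 * (i : ℝ) ≤ n := by exact_mod_cast h
    have hle : invSqrtCoeff j ≤ invSqrtCoeff n * (1 + i / n) := by
      refine le_of_sq_le_sq ?_ (by positivity)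
      have hm : invSqrtCoeff j ^ 2 * (4 * j + 1) ≤ invSqrtCoeff n ^ 2 * (4 * n + 1) :=
        invSqrtCoeff_sq_mul_monotone (by omega : j ≤ n)
      have hq : (4 * (n : ℝ) + 1) ≤ (1 + i / n) ^ 2 * (4 * j + 1) := by
        set q : ℝ := i / n with hq
        have hiq : (i : ℝ) = q * n := by rw [hq]; field_simp
        have hq0 : 0 ≤ q := by positivity
        have hq1 : q ≤ 1 / 2 := by rw [hq, div_le_iff₀ hn0]; linarith
        have hjq : (j : ℝ) = n - q * n := by linarith
        rw [hjq]
        -- The cutoff `q ≤ 1/2` is what makes the first-order terms in `q` nonnegative.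
        have hp : 0 ≤ q * n * (1 - 2 * q) := by
          apply mul_nonneg (by positivity); linarith
        have hp2 : 0 ≤ q ^ 2 * (4 * (n - q * n) + 1) := by
          apply mul_nonneg (by positivity); nlinarith
        nlinarith
      have hjp : (0 : ℝ) < 4 * j + 1 := by positivity
      refine le_of_mul_le_mul_right (hm.trans ?_) hjp
      rw [mul_pow, mul_assoc]
      gcongr
    calc invSqrtCoeff i * invSqrtCoeff j * (τ ^ 2) ^ i
        ≤ invSqrtCoeff i * (invSqrtCoeff n * (1 + i / n)) * (τ ^ 2) ^ i := by gcongr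
      _ = invSqrtCoeff n * (invSqrtCoeff i * (τ ^ 2) ^ i)
          + invSqrtCoeff n / n * (i * (invSqrtCoeff i * (τ ^ 2) ^ i)) := by ring
      _ ≤ _ := le_add_of_nonneg_right (by positivity)
  · have hle : invSqrtCoeff i ≤ 2 * invSqrtCoeff n := by
      refine le_of_sq_le_sq ?_ (by positivity)
      have hr : (n : ℝ) + 1 ≤ 2 * i := by exact_mod_cast h
      have e1 := invSqrtCoeff_sq_le i
      have e2 := one_le_invSqrtCoeff_sq n
      have hp : (0 : ℝ) < n + 2 := by positivity
      refine le_of_mul_le_mul_right ?_ hp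
      nlinarith [sq_nonneg (invSqrtCoeff i), sq_nonneg (invSqrtCoeff n)]
    have hpow : (τ ^ 2) ^ i ≤ τ ^ n := by
      rw [← pow_mul]; exact pow_le_pow_of_le_one h0 h1 h.le
    calc invSqrtCoeff i * invSqrtCoeff j * (τ ^ 2) ^ i
        ≤ (2 * invSqrtCoeff n) * invSqrtCoeff j * τ ^ n := by gcongr
      _ = 2 * invSqrtCoeff n * τ ^ n * invSqrtCoeff j := by ring
      _ ≤ _ := le_add_of_nonneg_left (by positivity)

theorem sum_antidiagonal_mul_pow_mul_sqrt_le {n : ℕ} (hn : n ≠ 0) {τ : ℝ}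
    (h0 : 0 ≤ τ) (h1 : τ < 1) :
    (∑ ij ∈ antidiagonal n, invSqrtCoeff ij.1 * invSqrtCoeff ij.2 * (τ ^ 2) ^ ij.1) * √(1 - τ ^ 2)
      ≤ invSqrtCoeff n * (1 + 1 / (2 * (n * (1 - τ ^ 2)))
        + 2 * τ ^ n * √((2 * n + 1) * (1 - τ ^ 2))) := by
  have ha := invSqrtCoeff_pos n
  have hn0 : (0 : ℝ) < n := by positivity
  have hr0 : 0 ≤ τ ^ 2 := by positivity
  have hr1 : τ ^ 2 < 1 := pow_lt_one₀ h0 h1 two_ne_zero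
  set r := τ ^ 2 with hr
  have hr' : 0 < 1 - r := by linarith
  set f := ∑ k ∈ range (n + 1), invSqrtCoeff k * r ^ k with hf
  have hfs : f * √(1 - r) ≤ 1 := by
    refine le_of_le_of_eq ?_ (tsum_invSqrtCoeff hr0 hr1)
    refine mul_le_mul_of_nonneg_right ?_ (Real.sqrt_nonneg _)
    refine Summable.sum_le_tsum _ (fun k _ => mul_nonneg (invSqrtCoeff_pos k).le (by positivity)) ?_
    refine Summable.of_nonneg_of_le (fun k => mul_nonneg (invSqrtCoeff_pos k).le (by positivity))
      (fun k => mul_le_of_le_one_left (by positivity) (invSqrtCoeff_le_one k))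
      (summable_geometric_of_lt_one hr0 hr1)
  have hg : ∑ k ∈ range (n + 1), (k : ℝ) * (invSqrtCoeff k * r ^ k) ≤ f / (2 * (1 - r)) := by
    rw [le_div_iff₀ (by positivity)]
    have e := sum_mul_invSqrtCoeff_mul_pow n r
    have e2 : ∑ k ∈ range (n + 1), (2 * (k : ℝ) + 1) * invSqrtCoeff k * r ^ k
        = 2 * ∑ k ∈ range (n + 1), (k : ℝ) * (invSqrtCoeff k * r ^ k) + f := by
      rw [hf, mul_sum, ← sum_add_distrib]
      exact sum_congr rfl fun k _ => by ring
    have e3 : 0 ≤ f := sum_nonneg fun k _ => mul_nonneg (invSqrtCoeff_pos k).le (by positivity)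
    have e4 : 0 ≤ (2 * (n : ℝ) + 1) * invSqrtCoeff n * r ^ (n + 1) := by positivity
    rw [e2] at e
    nlinarith [mul_nonneg hr'.le e3]
  have hs : ∑ j ∈ range (n + 1), invSqrtCoeff j ≤ √(2 * n + 1) := by
    rw [sum_range_invSqrtCoeff]
    apply Real.le_sqrt_of_sq_le
    have := invSqrtCoeff_sq_le n
    have hp : (0 : ℝ) ≤ 2 * n + 1 := by positivity
    nlinarith
  have e1 : ∀ φ : ℕ → ℝ, ∑ ij ∈ antidiagonal n, φ ij.1 = ∑ i ∈ range (n + 1), φ i := fun φ =>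
    Finset.Nat.sum_antidiagonal_eq_sum_range_succ_mk (fun ij : ℕ × ℕ => φ ij.1) n
  have e2 : ∑ ij ∈ antidiagonal n, invSqrtCoeff ij.2 = ∑ i ∈ range (n + 1), invSqrtCoeff i := by
    rw [← e1, ← Finset.Nat.sum_antidiagonal_swap]; rfl
  have hsum := sum_le_sum fun (ij : ℕ × ℕ) (hij : ij ∈ antidiagonal n) =>
    invSqrtCoeff_mul_mul_pow_le hn (HasAntidiagonal.mem_antidiagonal.1 hij) h0 h1.le
  rw [sum_add_distrib, sum_add_distrib, ← mul_sum, ← mul_sum, ← mul_sum, e2,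
    e1 fun i => invSqrtCoeff i * r ^ i, e1 fun i => (i : ℝ) * (invSqrtCoeff i * r ^ i)] at hsum
  have hs0 := Real.sqrt_nonneg (1 - r)
  calc _ ≤ (invSqrtCoeff n * f + invSqrtCoeff n / n * (f / (2 * (1 - r)))
        + 2 * invSqrtCoeff n * τ ^ n * √(2 * n + 1)) * √(1 - r) := by
        refine mul_le_mul_of_nonneg_right (hsum.trans ?_) hs0
        gcongr
    _ = invSqrtCoeff n * ((f * √(1 - r)) * (1 + 1 / (2 * (n * (1 - r))))
        + 2 * τ ^ n * (√(2 * n + 1) * √(1 - r))) := by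
        field_simp
    _ ≤ invSqrtCoeff n * (1 * (1 + 1 / (2 * (n * (1 - r))))
        + 2 * τ ^ n * √((2 * n + 1) * (1 - r))) := by
        rw [Real.sqrt_mul (by positivity)]
        gcongr
    _ = _ := by ring

/-- Of the `2 a_n` available, the value at `‖t‖²` uses `a_n` plus the first two errors, and the tail
uses the third; keeping their sum below `1/2` leaves `a_n / 2`. -/
theorem legendrePAux_lower_bound {n : ℕ} (hn : n ≠ 0) {t : ℂ} (ht : ‖t‖ < 1)
    (h : 1 / (2 * (n * (1 - ‖t‖ ^ 2))) + 2 * ‖t‖ ^ n * √((2 * n + 1) * (1 - ‖t‖ ^ 2))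
      + 6 * (‖t‖ ^ n) ^ 2 * (1 + Real.log (n + 1)) ≤ 1 / 2) :
    invSqrtCoeff n / 2 ≤ ‖legendrePAux n (t ^ 2) * sqrtSeries (t ^ 2)‖ := by
  have ha := invSqrtCoeff_pos n
  have h1 := norm_legendrePAux_ge (n := n) (norm_sq_lt_one ht)
  rw [norm_pow] at h1
  have h2 := sum_antidiagonal_mul_pow_mul_sqrt_le hn (norm_nonneg t) ht
  have h3 := mul_le_mul_of_nonneg_left (sum_invSqrtCoeff_mul_sq_le n)
    (by positivity : 0 ≤ (‖t‖ ^ 2) ^ n)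
  have h4 : (‖t‖ ^ 2) ^ n = (‖t‖ ^ n) ^ 2 := by rw [← pow_mul, ← pow_mul, mul_comm]
  rw [h4] at h1 h3
  have h5 := mul_le_mul_of_nonneg_left h ha.le
  linarith

/-! ### Specialisation to the shrinking ellipse -/

/-- From `log (1 + x) ≥ x - x²` with `x = y / n`: the exponent is at most `-y + n x²`, and `n x² = y
(y / n) ≤ 1`. -/
theorem inv_one_add_div_pow_le {n : ℕ} (hn : n ≠ 0) {y : ℝ} (hy : 0 < y)
    (hyx : y * (y / n) ≤ 1) : (1 + y / n)⁻¹ ^ n ≤ Real.exp (1 - y) := by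
  have hn0 : (0 : ℝ) < n := by positivity
  set x := y / n with hx
  have hx0 : 0 < x := by positivity
  have hnx : n * x = y := by rw [hx]; field_simp
  have hlog : x - x ^ 2 ≤ Real.log (1 + x) := by
    refine le_trans ?_ (Real.one_sub_inv_le_log_of_pos (by positivity : 0 < 1 + x))
    have : (1 + x) * (1 + x)⁻¹ = 1 := mul_inv_cancel₀ (by positivity)
    have h2 : (1 + x)⁻¹ ≤ 1 - x + x ^ 2 := by
      rw [inv_le_iff_one_le_mul₀ (by positivity)]
      nlinarith [pow_pos hx0 3]
    linarith
  rw [← Real.exp_log (by positivity : 0 < (1 + x)⁻¹), ← Real.exp_nat_mul, Real.exp_le_exp,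
    Real.log_inv]
  have h1 := mul_le_mul_of_nonneg_left hlog hn0.le
  nlinarith

theorem legendrePAux_lower_bound_of_norm_eq {n : ℕ} (hn : 2 ≤ n) {M : ℝ} (hM : 0 < M) {t : ℂ}
    (ht : ‖t‖ = (1 + M * Real.log n / n)⁻¹) (hx1 : M * Real.log n / n ≤ 1)
    (hyx : M * Real.log n * (M * Real.log n / n) ≤ 1)
    (h : 1 / (M * Real.log n)
      + 2 * Real.exp (1 - M * Real.log n) * (6 * (M * Real.log n) + 1)
      + 6 * Real.exp (1 - M * Real.log n) ^ 2 * (2 + M * Real.log n / M) ≤ 1 / 2) :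
    invSqrtCoeff n / 2 ≤ ‖legendrePAux n (t ^ 2) * sqrtSeries (t ^ 2)‖ := by
  have hn0 : (0 : ℝ) < n := by positivity
  have hn1 : (1 : ℝ) < n := by exact_mod_cast hn
  have hlog : 0 < Real.log n := Real.log_pos hn1
  have hlog' : M * Real.log n / M = Real.log n := by field_simp
  rw [hlog'] at h
  set y := M * Real.log n with hy
  have hy0 : 0 < y := by positivity
  have hpow := inv_one_add_div_pow_le (by omega : n ≠ 0) hy0 hyx
  rw [← ht] at hpow
  set x := y / n with hx
  have hx0 : 0 < x := by positivity
  have hnx : n * x = y := by rw [hx]; field_simp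
  set τ := ‖t‖ with hτ
  have hτ0 : 0 ≤ τ := norm_nonneg t
  have hτx : τ * (1 + x) = 1 := by rw [ht]; exact inv_mul_cancel₀ (by positivity)
  have hτ1 : τ < 1 := by
    rw [ht]; exact inv_lt_one_of_one_lt₀ (by linarith)
  have hlow : x / 2 ≤ 1 - τ ^ 2 := by
    have h1 : τ ^ 2 ≤ τ := by nlinarith
    have h2 : 1 - τ = τ * x := by linarith
    have h3 : 1 / 2 ≤ τ := by nlinarith
    nlinarith
  have hup : 1 - τ ^ 2 ≤ 2 * x := by nlinarith
  refine legendrePAux_lower_bound (by omega) hτ1 (le_trans ?_ h)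
  have hA : 1 / (2 * (n * (1 - τ ^ 2))) ≤ 1 / y := by
    apply one_div_le_one_div_of_le hy0
    nlinarith
  have hB : √((2 * n + 1) * (1 - τ ^ 2)) ≤ 6 * y + 1 := by
    rw [Real.sqrt_le_iff]
    refine ⟨by positivity, ?_⟩
    have h1 : (2 * (n : ℝ) + 1) * (1 - τ ^ 2) ≤ (3 * n) * (2 * x) :=
      mul_le_mul (by linarith) hup (by linarith) (by positivity)
    nlinarith
  have hC : 1 + Real.log (n + 1) ≤ 2 + Real.log n := by
    have h1 : Real.log (n + 1) ≤ Real.log (2 * n) := Real.log_le_log (by positivity) (by linarith)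
    rw [Real.log_mul two_ne_zero hn0.ne'] at h1
    have h2 := Real.log_le_sub_one_of_pos (two_pos : (0 : ℝ) < 2)
    linarith
  have hD : 0 ≤ 1 + Real.log ((n : ℝ) + 1) := by
    have := Real.log_nonneg (by linarith : (1 : ℝ) ≤ n + 1)
    linarith
  gcongr

theorem tendsto_error_bound (M : ℝ) :
    Tendsto (fun y : ℝ => 1 / y + 2 * Real.exp (1 - y) * (6 * y + 1)
      + 6 * Real.exp (1 - y) ^ 2 * (2 + y / M)) atTop (nhds 0) := by
  have h0 := Real.tendsto_pow_mul_exp_neg_atTop_nhds_zero 0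
  have h1 := Real.tendsto_pow_mul_exp_neg_atTop_nhds_zero 1
  have hinv : Tendsto (fun y : ℝ => 1 / y) atTop (nhds 0) := by
    simpa using tendsto_inv_atTop_zero (𝕜 := ℝ)
  have h2 := (hinv.add ((h1.const_mul (12 * Real.exp 1)).add (h0.const_mul (2 * Real.exp 1)))).add
    (((h0.mul h0).const_mul (12 * Real.exp 1 ^ 2)).add
      ((h0.mul h1).const_mul (6 * Real.exp 1 ^ 2 / M)))
  simp only [mul_zero, add_zero] at h2
  refine h2.congr fun y => ?_
  rw [sub_eq_add_neg, Real.exp_add]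
  ring

theorem tendsto_mul_log_natCast {M : ℝ} (hM : 0 < M) :
    Tendsto (fun n : ℕ => M * Real.log n) atTop atTop :=
  (Real.tendsto_log_atTop.comp tendsto_natCast_atTop_atTop).const_mul_atTop hM

theorem tendsto_log_pow_div_natCast (k : ℕ) :
    Tendsto (fun n : ℕ => Real.log n ^ k / (n : ℝ)) atTop (nhds 0) := by
  have h := (Real.tendsto_pow_log_div_mul_add_atTop 1 0 k one_ne_zero).comp
    (tendsto_natCast_atTop_atTop (R := ℝ))
  simpa [Function.comp_def] using h

end GaussLegendre

theorem corollary2p4 (M : ℝ) (hM : 0 < M) :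
    ∃ C : ℝ, ∀ᶠ n : ℕ in atTop,
      ∀ z ∈ GaussLegendre.bernsteinEllipse (1 + M * Real.log (n : ℝ) / (n : ℝ)),
        (GaussLegendre.legendreP n).eval z ≠ 0 ∧
          ‖GaussLegendre.legendreQ n z / (GaussLegendre.legendreP n).eval z‖
            ≤ C * (n : ℝ) ^ (-(2 * M)) := by
  -- `16` is the quotient of the bounds `8 a_n` and `a_n / 2`; `e²` comes from squaring `e^(1-y)`.
  refine ⟨16 * Real.exp 2, ?_⟩
  have hx := (GaussLegendre.tendsto_log_pow_div_natCast 1).const_mul M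
  have hyx := (GaussLegendre.tendsto_log_pow_div_natCast 2).const_mul (M ^ 2)
  rw [mul_zero] at hx hyx
  have herr := (GaussLegendre.tendsto_error_bound M).comp (GaussLegendre.tendsto_mul_log_natCast hM)
  filter_upwards [eventually_ge_atTop 2, hx.eventually_le_const one_pos,
    hyx.eventually_le_const one_pos, herr.eventually_le_const one_half_pos] with n hn h1 h2 h3 z hz
  have hn1 : (1 : ℝ) < n := by exact_mod_cast hn
  have hn0 : (0 : ℝ) < n := by linarith
  have hlog : 0 < Real.log n := Real.log_pos hn1
  have hx0 : 0 < M * Real.log n / n := by positivity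
  have hx1 : M * Real.log n / n ≤ 1 := le_of_eq_of_le (by ring) h1
  have hyx1 : M * Real.log n * (M * Real.log n / n) ≤ 1 := le_of_eq_of_le (by ring) h2
  obtain ⟨t, ht, htz⟩ := GaussLegendre.exists_joukowski_of_mem_bernsteinEllipse hz
  have ht1 : ‖t‖ < 1 := by
    rw [ht]; exact inv_lt_one_of_one_lt₀ (by linarith)
  obtain ⟨hP, hle⟩ := GaussLegendre.norm_legendreQ_div_legendreP_le ht1 htz
    (GaussLegendre.legendrePAux_lower_bound_of_norm_eq hn hM ht hx1 hyx1 h3)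
  refine ⟨hP, hle.trans ?_⟩
  have hpow := GaussLegendre.inv_one_add_div_pow_le (by omega : n ≠ 0)
    (by positivity : 0 < M * Real.log n) hyx1
  rw [← ht] at hpow
  calc 16 * (‖t‖ ^ 2) ^ n = 16 * (‖t‖ ^ n) ^ 2 := by rw [← pow_mul, ← pow_mul, mul_comm 2 n]
    _ ≤ 16 * Real.exp (1 - M * Real.log n) ^ 2 := by gcongr
    _ = 16 * Real.exp 2 * (n : ℝ) ^ (-(2 * M)) := by
        rw [Real.rpow_def_of_pos hn0, mul_assoc, ← Real.exp_add, ← Real.exp_nat_mul]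
        congr 2
        push_cast
        ring
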